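/- Let $B\subset\mathbb C$ be a connected open set and let $\mathcal V$ be a polarized rational variation of Hodge structures of weight $3$ over $B$ with constant underlying local system $V_{\mathbb Q}\cong\mathbb Q^4$ and alternating form $Q$: for every $b\in B$ there is a Hodge decomposition $V_{\mathbb C}=\bigoplus_{p+q=3}H^{p,q}_b$ with $\overline{H^{p,q}_b}=H^{q,p}_b$; the spaces $F^p_b=\bigoplus_{r\ge p}H^{r,3-r}_b$ form holomorphic subbundles; derivatives of sections of $F^{p+1}$ lie in $F^{p}$; $Q(H_b^{p,q},H_b^{r,s})=0$ unless $(r,s)=(q,p)$; and $i^{q-p}Q(v,\bar v)>0$ for $0\ne v\in H_b^{p,q}$. Assume that $\mathcal V$ is Calabi-Yau like with $h^{3,0}=h^{2,1}=h^{1,2}=h^{0,3}=1$, that is, $F^2$ is generated by the local holomorphic sections of $F^3$ and their derivatives, and $F^1=(F^3)^{\perp}$ with respect to $Q$. (For instance, $\mathcal V$ is the variation of Hodge structures on $H^3$ of the local universal deformation $\mathcal X\to B$ of a Calabi-Yau 3-manifold with $h^{2,1}=1$.) For $b\in B$ let $h_b:S^1\to \mathrm{GL}(V_{\mathbb R})$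 be the representation with $h_b(z)v=z^p\bar z^qv$ for $v\in H^{p,q}_b$, and let $\mathrm{Hg}_b$ be the Hodge group, the smallest $\mathbb Q$-algebraic subgroup $G$ of $\mathrm{GL}(V_{\mathbb Q})$ with $h_b(S^1)\subset G(\mathbb R)$. Let $\mathrm{Hg}$ be the generic Hodge group, i.e. the smallest $\mathbb Q$-algebraic subgroup of $\mathrm{GL}(V_{\mathbb Q})$ containing all $\mathrm{Hg}_b$, $b \in B$ (it is the maximum of the groups $\mathrm{Hg}_b$). Fix $o\in B$, put $h=h_o$, and let $v_{p,3-p}\in H^{p,3-p}_o$ be a basis of $V_{\mathbb C}$ with $\bar v_{p,3-p}=v_{3-p,p}$ and $Q(iv_{3,0},v_{0,3})=Q(-iv_{2,1},v_{1,2})=1$. Then: 1. Every element of the center of $\mathrm{Hg}(\mathbb R)$ is given by a diagonal matrix $\mathrm{diag}(\xi,\xi,\bar\xi,\bar\xi)$ with $\xi\in\mathbb C$, $|\xi|=1$, with respect to the basis $\{v_{3,0},v_{2,1},v_{1,2},v_{0,3}\}$. 2. Let $\mathrm{ad}$ denote the adjoint representation of $\mathrm{Hg}(\mathbb R)$ on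 the Lie algebra of $\mathrm{Hg}_{\mathbb R}$. The kernel of $\mathrm{ad}\circ h:S^1\to\mathrm{GL}(\mathrm{Lie}(\mathrm{Hg}_{\mathbb R}))$ is $\{\pm1\}$. -/

import Mathlib

namespace CYHodge

noncomputable section

/-! ### Hodge structures of weight 3 on `ℚ⁴`

The rational vector space is `Fin 4 → ℚ` (a rational vector space of dimension 4 with a chosen
basis); its real points are `Fin 4 → ℝ` and its complexification is `Fin 4 → ℂ`, on which complex
conjugation is `star`. -/

/-- A real Hodge structure of weight 3 with types `(3,0), (2,1), (1,2), (0,3)` on `ℝ⁴`: the space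
`H p` is `H^{p,3-p}`. Note that `p.rev` is `3 - p`. -/
structure HodgeStructure where
  H : Fin 4 → Submodule ℂ (Fin 4 → ℂ)
  isInternal : DirectSum.IsInternal H
  conj_mem : ∀ p : Fin 4, ∀ v ∈ H p, star v ∈ H p.rev

namespace HodgeStructure

variable (h : HodgeStructure)

/-- The Hodge filtration `F^p = ⨁_{r ≥ p} H^{r,3-r}`. -/
def F (p : ℕ) : Submodule ℂ (Fin 4 → ℂ) :=
  ⨆ r : Fin 4, ⨆ _ : p ≤ (r : ℕ), h.H r

/-- The character `z ↦ z^p * conj z ^ (3-p)` of the circle. -/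
def character (p : Fin 4) (z : Circle) : ℂ :=
  (z : ℂ) ^ (p : ℕ) * (starRingEnd ℂ (z : ℂ)) ^ (3 - (p : ℕ))

lemma bijective_coeLinearMap : Function.Bijective (DirectSum.coeLinearMap h.H) :=
  h.isInternal

/-- The projection of `ℂ⁴` onto `H^{p,3-p}` along the other summands of the Hodge decomposition. -/
def proj (p : Fin 4) : (Fin 4 → ℂ) →ₗ[ℂ] (Fin 4 → ℂ) :=
  (h.H p).subtype ∘ₗ DirectSum.component ℂ (Fin 4) (fun i => h.H i) p ∘ₗ
    (LinearEquiv.ofBijective (DirectSum.coeLinearMap h.H) h.bijective_coeLinearMap).symm.toLinearMap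

/-- The endomorphism of `ℂ⁴` which is multiplication by `z^p * conj z ^ (3-p)` on `H^{p,3-p}`. -/
def complexRep (z : Circle) : (Fin 4 → ℂ) →ₗ[ℂ] (Fin 4 → ℂ) :=
  ∑ p, character p z • h.proj p

lemma proj_of_mem {p : Fin 4} {v : Fin 4 → ℂ} (hv : v ∈ h.H p) (q : Fin 4) :
    h.proj q v = if q = p then v else 0 := by
  have key : (LinearEquiv.ofBijective (DirectSum.coeLinearMap h.H) h.bijective_coeLinearMap).symm v
      = DirectSum.lof ℂ (Fin 4) (fun i => h.H i) p ⟨v, hv⟩ := by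
    rw [LinearEquiv.symm_apply_eq]
    simp
  simp only [proj, LinearMap.comp_apply, LinearEquiv.coe_coe, key]
  split_ifs with hq
  · subst hq
    simp [DirectSum.component.lof_self]
  · simp [DirectSum.component.of, Ne.symm hq]

lemma complexRep_of_mem {p : Fin 4} {v : Fin 4 → ℂ} (hv : v ∈ h.H p) (z : Circle) :
    h.complexRep z v = character p z • v := by
  simp [complexRep, LinearMap.sum_apply, h.proj_of_mem hv]

/-- Two additive maps that agree on all `H^{p,3-p}` are equal. -/
lemma addHom_ext {f g : (Fin 4 → ℂ) →+ (Fin 4 → ℂ)}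
    (hfg : ∀ p : Fin 4, ∀ v ∈ h.H p, f v = g v) : f = g := by
  refine AddMonoidHom.ext fun v => ?_
  have hv : v ∈ ⨆ p, h.H p := by
    rw [h.isInternal.submodule_iSup_eq_top]; trivial
  induction hv using Submodule.iSup_induction' with
  | mem p x hx => exact hfg p x hx
  | zero => simp
  | add x y _ _ hx hy => simp [hx, hy]

lemma complexRep_one : h.complexRep 1 = 1 := by
  have := h.addHom_ext (f := (h.complexRep 1).toAddMonoidHom)
    (g := (1 : Module.End ℂ (Fin 4 → ℂ)).toAddMonoidHom) (fun p v hv => by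
      simp [h.complexRep_of_mem hv, character])
  ext1 v
  exact LinearMap.ext (fun w => DFunLike.congr_fun this _)

lemma complexRep_mul (z w : Circle) :
    h.complexRep (z * w) = h.complexRep z * h.complexRep w := by
  have := h.addHom_ext (f := (h.complexRep (z * w)).toAddMonoidHom)
    (g := (h.complexRep z * h.complexRep w).toAddMonoidHom) (fun p v hv => by
      simp only [LinearMap.toAddMonoidHom_coe, Module.End.mul_apply, h.complexRep_of_mem hv,
        map_smul, smul_smul]
      congr 1
      simp only [character, Circle.coe_mul, map_mul]
      ring)
  ext1 v
  exact LinearMap.ext (fun w => DFunLike.congr_fun this _)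

lemma star_character (p : Fin 4) (z : Circle) :
    star (character p.rev z) = character p z := by
  fin_cases p <;> simp [character, Fin.rev] <;> ring

/-- The endomorphism `complexRep z` is real. -/
lemma star_complexRep_star (z : Circle) (v : Fin 4 → ℂ) :
    star (h.complexRep z (star v)) = h.complexRep z v := by
  have := h.addHom_ext
    (f := (starAddEquiv.toAddMonoidHom.comp (h.complexRep z).toAddMonoidHom).comp
      (starAddEquiv (R := Fin 4 → ℂ)).toAddMonoidHom)
    (g := (h.complexRep z).toAddMonoidHom) (fun p v hv => by
      simp [h.complexRep_of_mem hv, h.complexRep_of_mem (h.conj_mem p v hv), star_smul,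
        star_character])
  exact DFunLike.congr_fun this v

/-- The matrix of `complexRep z` in the standard basis has real entries; these form `realMatrix z`. -/
def realMatrix (z : Circle) : Matrix (Fin 4) (Fin 4) ℝ :=
  (LinearMap.toMatrix' (h.complexRep z)).map Complex.re

lemma realMatrix_map (z : Circle) :
    (h.realMatrix z).map Complex.ofRealHom = LinearMap.toMatrix' (h.complexRep z) := by
  ext i j
  simp only [realMatrix, Matrix.map_apply, LinearMap.toMatrix'_apply, Complex.ofRealHom_eq_coe]
  apply Complex.conj_eq_iff_re.mp
  have := congrFun (h.star_complexRep_star z (Pi.single j 1)) i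
  have h1 : star (Pi.single j 1 : Fin 4 → ℂ) = Pi.single j 1 := by
    ext k; by_cases hk : k = j <;> simp [hk]
  rw [h1] at this
  simpa using this

lemma map_ofReal_injective :
    Function.Injective (fun M : Matrix (Fin 4) (Fin 4) ℝ => M.map Complex.ofRealHom) :=
  Matrix.map_injective Complex.ofReal_injective

/-- The representation `h : S¹ → GL(ℝ⁴)` attached to the Hodge structure: `h(z)` acts on
`H^{p,q}` as multiplication by `z^p * conj z ^ q`. -/
def rep : Circle →* GL (Fin 4) ℝ :=
  MonoidHom.toHomUnits
    { toFun := h.realMatrix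
      map_one' := by
        apply map_ofReal_injective
        simp [realMatrix_map, complexRep_one]
      map_mul' := fun z w => by
        apply map_ofReal_injective
        simp only [realMatrix_map, complexRep_mul, Matrix.map_mul, LinearMap.toMatrix'_mul] }

/-- The defining property of `rep`. -/
lemma rep_mulVec {p : Fin 4} {v : Fin 4 → ℂ} (hv : v ∈ h.H p) (z : Circle) :
    ((h.rep z : Matrix (Fin 4) (Fin 4) ℝ).map Complex.ofRealHom).mulVec v =
      ((z : ℂ) ^ (p : ℕ) * (starRingEnd ℂ (z : ℂ)) ^ (3 - (p : ℕ))) • v := by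
  have : (h.rep z : Matrix (Fin 4) (Fin 4) ℝ) = h.realMatrix z := rfl
  rw [this, realMatrix_map, LinearMap.toMatrix'_mulVec, h.complexRep_of_mem hv, character]

end HodgeStructure

/-! ### Algebraic subgroups of `GL₄` over `ℚ`

A `ℚ`-algebraic subgroup of `GL₄` is given by its group of complex points, which is a subgroup of
`GL₄(ℂ)` cut out by polynomial equations with rational coefficients. -/

/-- The subgroup `G` of `GL₄(ℂ)` is the group of complex points of a `ℚ`-algebraic subgroup. -/
def IsRatAlgebraic (G : Subgroup (GL (Fin 4) ℂ)) : Prop :=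
  ∃ S : Set (MvPolynomial (Fin 4 × Fin 4) ℚ), ∀ g : GL (Fin 4) ℂ,
    g ∈ G ↔ ∀ P ∈ S, MvPolynomial.aeval (fun ij => (g : Matrix (Fin 4) (Fin 4) ℂ) ij.1 ij.2) P = 0

lemma IsRatAlgebraic.sInf {C : Set (Subgroup (GL (Fin 4) ℂ))} (hC : ∀ G ∈ C, IsRatAlgebraic G) :
    IsRatAlgebraic (sInf C) := by
  choose! S hS using hC
  refine ⟨⋃ G ∈ C, S G, fun g => ?_⟩
  simp only [Subgroup.mem_sInf, Set.mem_iUnion, exists_prop, forall_exists_index, and_imp]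
  constructor
  · intro hg P G hG hP
    exact (hS G hG g).1 (hg G hG) P hP
  · intro hg G hG
    exact (hS G hG g).2 fun P hP => hg P G hG hP

/-- The inclusion `GL₄(ℝ) → GL₄(ℂ)`. -/
def complexify : GL (Fin 4) ℝ →* GL (Fin 4) ℂ :=
  Matrix.GeneralLinearGroup.map Complex.ofRealHom

/-- The group `G(ℝ)` of real points. -/
def realPoints (G : Subgroup (GL (Fin 4) ℂ)) : Subgroup (GL (Fin 4) ℝ) :=
  G.comap complexify

/-- The Hodge group: the smallest `ℚ`-algebraic subgroup `G` of `GL₄` with `h(S¹) ⊆ G(ℝ)`. -/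
def hodgeGroup (h : HodgeStructure) : Subgroup (GL (Fin 4) ℂ) :=
  sInf {G | IsRatAlgebraic G ∧ ∀ z, h.rep z ∈ realPoints G}

lemma isRatAlgebraic_hodgeGroup (h : HodgeStructure) : IsRatAlgebraic (hodgeGroup h) :=
  IsRatAlgebraic.sInf fun _ hG => hG.1

lemma rep_mem_hodgeGroup (h : HodgeStructure) (z : Circle) :
    h.rep z ∈ realPoints (hodgeGroup h) := by
  simp only [realPoints, Subgroup.mem_comap, hodgeGroup, Subgroup.mem_sInf]
  exact fun G hG => hG.2 z

/-! ### The Lie algebra and the adjoint representation -/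

/-- The derivative at the identity matrix of the polynomial function `P` in the direction `X`. -/
def derivAtOne (P : MvPolynomial (Fin 4 × Fin 4) ℝ) (X : Matrix (Fin 4) (Fin 4) ℝ) : ℝ :=
  ∑ ij : Fin 4 × Fin 4, X ij.1 ij.2 *
    MvPolynomial.eval (fun kl => (1 : Matrix (Fin 4) (Fin 4) ℝ) kl.1 kl.2)
      (MvPolynomial.pderiv ij P)

/-- The real polynomial `P` vanishes on `G`. -/
def VanishesOn (G : Subgroup (GL (Fin 4) ℂ)) (P : MvPolynomial (Fin 4 × Fin 4) ℝ) : Prop :=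
  ∀ g ∈ G, MvPolynomial.aeval (fun ij => (g : Matrix (Fin 4) (Fin 4) ℂ) ij.1 ij.2) P = 0

/-- The Lie algebra of the real algebraic group `G_ℝ`, as a real vector space of matrices: the
tangent space at the identity, defined by the derivatives of the real polynomials that vanish
on `G`. -/
def lieAlgebra (G : Subgroup (GL (Fin 4) ℂ)) : Submodule ℝ (Matrix (Fin 4) (Fin 4) ℝ) where
  carrier := {X | ∀ P, VanishesOn G P → derivAtOne P X = 0}
  zero_mem' := fun P _ => by simp [derivAtOne]
  add_mem' := fun {X Y} hX hY P hP => by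
    have h1 := hX P hP
    have h2 := hY P hP
    simp only [derivAtOne] at h1 h2 ⊢
    simp only [Matrix.add_apply, add_mul, Finset.sum_add_distrib, h1, h2, add_zero]
  smul_mem' := fun c X hX P hP => by
    have h1 := hX P hP
    simp only [derivAtOne] at h1 ⊢
    simp only [Matrix.smul_apply, smul_eq_mul, mul_assoc, ← Finset.mul_sum, h1, mul_zero]

/-- The polynomial `x ↦ P (g * x * g⁻¹)`. -/
def conjPoly (g : GL (Fin 4) ℝ) (P : MvPolynomial (Fin 4 × Fin 4) ℝ) :
    MvPolynomial (Fin 4 × Fin 4) ℝ :=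
  MvPolynomial.aeval (fun ij : Fin 4 × Fin 4 => ∑ k, ∑ l,
    MvPolynomial.C ((g : Matrix (Fin 4) (Fin 4) ℝ) ij.1 k * (↑g⁻¹ : Matrix (Fin 4) (Fin 4) ℝ) l ij.2)
      * MvPolynomial.X (k, l)) P

lemma aeval_conjPoly {A : Type*} [CommRing A] [Algebra ℝ A] (g : GL (Fin 4) ℝ)
    (P : MvPolynomial (Fin 4 × Fin 4) ℝ) (x : Matrix (Fin 4) (Fin 4) A) :
    MvPolynomial.aeval (fun ij => x ij.1 ij.2) (conjPoly g P) =
      MvPolynomial.aeval (fun ij => ((g : Matrix (Fin 4) (Fin 4) ℝ).map (algebraMap ℝ A) * x *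
        (↑g⁻¹ : Matrix (Fin 4) (Fin 4) ℝ).map (algebraMap ℝ A)) ij.1 ij.2) P := by
  rw [conjPoly, ← AlgHom.comp_apply]
  congr 1
  apply MvPolynomial.algHom_ext
  rintro ⟨i, j⟩
  simp only [AlgHom.comp_apply, MvPolynomial.aeval_X, map_sum, map_mul, MvPolynomial.algHom_C,
    Matrix.mul_apply, Matrix.map_apply, Finset.sum_mul]
  rw [Finset.sum_comm]
  refine Finset.sum_congr rfl fun l _ => Finset.sum_congr rfl fun k _ => ?_
  ring

lemma aeval_one_add_inr (P : MvPolynomial (Fin 4 × Fin 4) ℝ) (X : Matrix (Fin 4) (Fin 4) ℝ) :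
    MvPolynomial.aeval (fun ij => ((1 : Matrix (Fin 4) (Fin 4) (DualNumber ℝ)) +
        X.map (TrivSqZeroExt.inr (R := ℝ))) ij.1 ij.2) P =
      (TrivSqZeroExt.inl (MvPolynomial.eval (fun kl => (1 : Matrix (Fin 4) (Fin 4) ℝ) kl.1 kl.2) P) +
        TrivSqZeroExt.inr (derivAtOne P X) : DualNumber ℝ) := by
  induction P using MvPolynomial.induction_on with
  | C a => simp [derivAtOne, TrivSqZeroExt.algebraMap_eq_inl]
  | add p q hp hq =>
    rw [map_add, hp, hq]
    ext <;> simp [derivAtOne, mul_add, Finset.sum_add_distrib]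
  | mul_X p ij hp =>
    have h1 : TrivSqZeroExt.fst ((1 : Matrix (Fin 4) (Fin 4) (DualNumber ℝ)) ij.1 ij.2) =
        (1 : Matrix (Fin 4) (Fin 4) ℝ) ij.1 ij.2 := by
      simp only [Matrix.one_apply]; split_ifs <;> simp
    have h2 : TrivSqZeroExt.snd ((1 : Matrix (Fin 4) (Fin 4) (DualNumber ℝ)) ij.1 ij.2) = 0 := by
      simp only [Matrix.one_apply]; split_ifs <;> simp
    rw [map_mul, hp, MvPolynomial.aeval_X]
    ext
    · simp [h1]
    · simp only [derivAtOne, MvPolynomial.pderiv_mul, MvPolynomial.pderiv_X, map_add, map_mul,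
        MvPolynomial.eval_X, mul_add, Finset.sum_add_distrib]
      simp only [Matrix.add_apply, Matrix.map_apply, TrivSqZeroExt.snd_mul, TrivSqZeroExt.fst_add,
        TrivSqZeroExt.snd_add, TrivSqZeroExt.fst_inl, TrivSqZeroExt.snd_inl,
        TrivSqZeroExt.fst_inr, TrivSqZeroExt.snd_inr, h1, h2, smul_eq_mul,
        MulOpposite.smul_eq_mul_unop, MulOpposite.unop_op]
      simp [Pi.single_apply, apply_ite, Finset.sum_mul]
      rw [add_comm, mul_comm (X ij.1 ij.2)]
      simp only [mul_assoc]

lemma derivAtOne_conjPoly (g : GL (Fin 4) ℝ) (P : MvPolynomial (Fin 4 × Fin 4) ℝ)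
    (X : Matrix (Fin 4) (Fin 4) ℝ) :
    derivAtOne (conjPoly g P) X =
      derivAtOne P ((g : Matrix (Fin 4) (Fin 4) ℝ) * X * (↑g⁻¹ : Matrix (Fin 4) (Fin 4) ℝ)) := by
  have h1 := aeval_one_add_inr (conjPoly g P) X
  have h2 := aeval_one_add_inr P
    ((g : Matrix (Fin 4) (Fin 4) ℝ) * X * (↑g⁻¹ : Matrix (Fin 4) (Fin 4) ℝ))
  rw [aeval_conjPoly] at h1
  have h3 : (g : Matrix (Fin 4) (Fin 4) ℝ).map (algebraMap ℝ (DualNumber ℝ)) *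
        (1 + X.map (TrivSqZeroExt.inr (R := ℝ))) *
        (↑g⁻¹ : Matrix (Fin 4) (Fin 4) ℝ).map (algebraMap ℝ (DualNumber ℝ)) =
      1 + ((g : Matrix (Fin 4) (Fin 4) ℝ) * X * (↑g⁻¹ : Matrix (Fin 4) (Fin 4) ℝ)).map
        (TrivSqZeroExt.inr (R := ℝ)) := by
    rw [mul_add, add_mul, mul_one, ← Matrix.map_mul, ← Units.val_mul, mul_inv_cancel]
    congr 1
    · simp
    · ext i j <;>
      simp [Matrix.mul_apply, TrivSqZeroExt.algebraMap_eq_inl, Finset.sum_mul, TrivSqZeroExt.fst_sum, TrivSqZeroExt.snd_sum]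
      refine Finset.sum_congr rfl fun k _ => Finset.sum_congr rfl fun l _ => ?_
      ring
  rw [h3, h2] at h1
  simpa using (congrArg TrivSqZeroExt.snd h1).symm

lemma conj_mem_lieAlgebra {G : Subgroup (GL (Fin 4) ℂ)} {g : GL (Fin 4) ℝ}
    (hg : g ∈ realPoints G) {X : Matrix (Fin 4) (Fin 4) ℝ} (hX : X ∈ lieAlgebra G) :
    (g : Matrix (Fin 4) (Fin 4) ℝ) * X * (↑g⁻¹ : Matrix (Fin 4) (Fin 4) ℝ) ∈ lieAlgebra G := by
  intro P hP
  rw [← derivAtOne_conjPoly]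
  refine hX _ fun x hx => ?_
  rw [aeval_conjPoly]
  exact hP (complexify g * x * (complexify g)⁻¹) (G.mul_mem (G.mul_mem hg hx) (G.inv_mem hg))

/-- The adjoint representation of `G(ℝ)` on the Lie algebra: `ad(g) X = g * X * g⁻¹`. -/
def ad (G : Subgroup (GL (Fin 4) ℂ)) : Representation ℝ (realPoints G) (lieAlgebra G) where
  toFun g :=
    { toFun := fun X => ⟨(g : GL (Fin 4) ℝ).val * X.1 * (g : GL (Fin 4) ℝ)⁻¹.val,
        conj_mem_lieAlgebra g.2 X.2⟩
      map_add' := fun X Y => Subtype.ext (by simp [mul_add, add_mul])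
      map_smul' := fun c X => Subtype.ext (by simp) }
  map_one' := by ext1 X; exact Subtype.ext (by simp)
  map_mul' g g' := by ext1 X; exact Subtype.ext (by simp [mul_assoc])

/-! ### Variations of Hodge structures -/

/-- `s` is a holomorphic section, defined on a neighbourhood of `b` in `B`, of the family of
subspaces `W`. -/
def IsLocalSection {B : Set ℂ} (W : B → Submodule ℂ (Fin 4 → ℂ)) (b : B)
    (s : ℂ → Fin 4 → ℂ) : Prop :=
  ∃ U : Set ℂ, IsOpen U ∧ b.1 ∈ U ∧ U ⊆ B ∧ DifferentiableOn ℂ s U ∧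
    ∀ b' : B, b'.1 ∈ U → s b' ∈ W b'

/-- The family of subspaces `W` is a holomorphic subbundle of the trivial bundle over `B` with
fibre `ℂ⁴`: locally it has a holomorphic frame. -/
def IsHolomorphicSubbundle {B : Set ℂ} (W : B → Submodule ℂ (Fin 4 → ℂ)) : Prop :=
  ∀ b : B, ∃ U : Set ℂ, IsOpen U ∧ b.1 ∈ U ∧ U ⊆ B ∧
    ∃ (k : ℕ) (s : Fin k → ℂ → Fin 4 → ℂ), (∀ j, DifferentiableOn ℂ (s j) U) ∧
      ∀ b' : B, b'.1 ∈ U → LinearIndependent ℂ (fun j => s j b') ∧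
        Submodule.span ℂ (Set.range fun j => s j b') = W b'

/-- The complex bilinear extension of the bilinear form on `ℚ⁴` with matrix `A`. -/
def bilin (A : Matrix (Fin 4) (Fin 4) ℚ) (v w : Fin 4 → ℂ) : ℂ :=
  v ⬝ᵥ (A.map (algebraMap ℚ ℂ)).mulVec w

/-- A polarized rational variation of Hodge structures of weight 3 over `B`, with the constant local
system `ℚ⁴`. -/
structure PolarizedVHS (B : Set ℂ) where
  /-- the Hodge structure of the fibre over `b` -/
  fiber : B → HodgeStructure
  /-- the matrix of the polarization -/
  Q : Matrix (Fin 4) (Fin 4) ℚ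
  Q_alternating : Q.transpose = -Q
  holomorphic : ∀ p, IsHolomorphicSubbundle fun b => (fiber b).F p
  transversal : ∀ p b s, IsLocalSection (fun b => (fiber b).F (p + 1)) b s →
    deriv s b ∈ (fiber b).F p
  /-- `H^{p,3-p}` and `H^{q,3-q}` are orthogonal unless `p + q = 3`. -/
  orthogonal : ∀ b, ∀ p q : Fin 4, q ≠ p.rev → ∀ v ∈ (fiber b).H p, ∀ w ∈ (fiber b).H q,
    bilin Q v w = 0
  /-- `i^{q-p} Q(v, v̄)`, a real number, is positive for `0 ≠ v ∈ H^{p,q}`, where `q = 3 - p`. -/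
  positive : ∀ b, ∀ p : Fin 4, ∀ v ∈ (fiber b).H p, v ≠ 0 →
    0 < (Complex.I ^ ((3 : ℤ) - 2 * (p : ℕ)) * bilin Q v (star v)).re

/-- A Calabi-Yau like variation of Hodge structures with Hodge numbers `1, 1, 1, 1`:
`F²` is generated by the sections of `F³` and their derivatives, and `F¹` is the orthogonal
complement of `F³`. -/
structure PolarizedVHS.IsCalabiYauLike {B : Set ℂ} (𝒱 : PolarizedVHS B) : Prop where
  hodgeNumber : ∀ b, ∀ p : Fin 4, Module.finrank ℂ ((𝒱.fiber b).H p) = 1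
  generated : ∀ b : B, (𝒱.fiber b).F 2 = Submodule.span ℂ
    {w | ∃ s, IsLocalSection (fun b => (𝒱.fiber b).F 3) b s ∧ (w = s b ∨ w = deriv s b)}
  F_one : ∀ b, ∀ v, v ∈ (𝒱.fiber b).F 1 ↔ ∀ w ∈ (𝒱.fiber b).F 3, bilin 𝒱.Q v w = 0

/-- The generic Hodge group: the smallest `ℚ`-algebraic subgroup of `GL₄` that contains the Hodge
groups of all fibres. It is the maximum of these Hodge groups, see
`PolarizedVHS.genericHodgeGroup_eq`. -/
def PolarizedVHS.genericHodgeGroup {B : Set ℂ} (𝒱 : PolarizedVHS B) : Subgroup (GL (Fin 4) ℂ) :=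
  sInf {G | IsRatAlgebraic G ∧ ∀ b, hodgeGroup (𝒱.fiber b) ≤ G}

lemma PolarizedVHS.isRatAlgebraic_genericHodgeGroup {B : Set ℂ} (𝒱 : PolarizedVHS B) :
    IsRatAlgebraic 𝒱.genericHodgeGroup :=
  IsRatAlgebraic.sInf fun _ hG => hG.1

lemma PolarizedVHS.hodgeGroup_le {B : Set ℂ} (𝒱 : PolarizedVHS B) (b : B) :
    hodgeGroup (𝒱.fiber b) ≤ 𝒱.genericHodgeGroup :=
  le_sInf fun _ hG => hG.2 b

lemma PolarizedVHS.genericHodgeGroup_eq {B : Set ℂ} (𝒱 : PolarizedVHS B)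
    {G : Subgroup (GL (Fin 4) ℂ)}
    (hG : IsGreatest (Set.range fun b => hodgeGroup (𝒱.fiber b)) G) :
    𝒱.genericHodgeGroup = G := by
  obtain ⟨⟨b, rfl⟩, hb⟩ := hG
  exact le_antisymm
    (sInf_le ⟨isRatAlgebraic_hodgeGroup _, fun b' => hb ⟨b', rfl⟩⟩) (𝒱.hodgeGroup_le b)

/-- The representation of `S¹` given by the fibre over `b`, with values in the group of real points
of the generic Hodge group. -/
def PolarizedVHS.rep {B : Set ℂ} (𝒱 : PolarizedVHS B) (b : B) :
    Circle →* realPoints 𝒱.genericHodgeGroup :=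
  (𝒱.fiber b).rep.codRestrict _ fun z => 𝒱.hodgeGroup_le b (rep_mem_hodgeGroup _ z)

/-- `(v 0, v 1, v 2, v 3) = (v_{3,0}, v_{2,1}, v_{1,2}, v_{0,3})` is a basis of `ℂ⁴` with
`v_{p,3-p} ∈ H^{p,3-p}`, with `v_{3-p,p}` conjugate to `v_{p,3-p}`, and with
`Q(i v_{3,0}, v_{0,3}) = Q(-i v_{2,1}, v_{1,2}) = 1`. -/
structure PolarizedVHS.IsHodgeBasis {B : Set ℂ} (𝒱 : PolarizedVHS B) (b : B)
    (v : Module.Basis (Fin 4) ℂ (Fin 4 → ℂ)) : Prop where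
  mem : ∀ j : Fin 4, v j ∈ (𝒱.fiber b).H j.rev
  conj : ∀ j : Fin 4, star (v j) = v j.rev
  norm_zero : bilin 𝒱.Q (Complex.I • v 0) (v 3) = 1
  norm_one : bilin 𝒱.Q (-Complex.I • v 1) (v 2) = 1

end

end CYHodge

/-! Both claims rest on a rigidity statement, `IsCalabiYauLike.exists_eigenvalue`: an endomorphism
`N` of `ℂ⁴` preserving every line `F³_b` is scalar on every `F²_b`. On a local frame `e` of `F³` one
has `N e = c e`. The function `c` is continuous with values in the finite spectrum of `N`, hence
locally constant. Differentiating `N s = c s` shows that sections of `F³` and their derivatives lie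
in one eigenspace, and these generate `F²`.

By `map_mem_of_commute`, `N` preserves `F³_b` once it commutes with an operator diagonal on the
Hodge decomposition of `b` whose eigenvalue on `H^{3,0}` occurs on no other summand.

A central `Z` commutes with all `h_b(z)`, so it is a scalar `ξ` on `F²_o`. Being real, it is `conj
ξ` on the conjugate vectors, and preserving `Q` forces `|ξ| = 1`.

If `ad (h_o(z))` is trivial, then `h_o(z)` commutes with the derivatives of all `h_b` at `1`, which
lie in the Lie algebra (`realDeriv_mem_lieAlgebra`). So it is scalar on `F²_o`, giving `z³ = z² z̄`
and `z² = 1`. Conversely `h_o(-1) = -1`, the weight being odd. -/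

namespace CYHodge

/-! ### Hodge projections, characters and the derivative of the circle action -/

namespace HodgeStructure

variable (h : HodgeStructure)

lemma proj_mem (p : Fin 4) (v : Fin 4 → ℂ) : h.proj p v ∈ h.H p := by
  simp [proj]

lemma proj_proj (p q : Fin 4) (v : Fin 4 → ℂ) :
    h.proj q (h.proj p v) = if q = p then h.proj p v else 0 :=
  h.proj_of_mem (h.proj_mem p v) q

lemma sum_proj (v : Fin 4 → ℂ) : ∑ p, h.proj p v = v := by
  have := LinearMap.congr_fun h.complexRep_one v
  simpa [complexRep, character, LinearMap.sum_apply] using this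

/-- An endomorphism that commutes with `∑ c_p • proj p` preserves the summand `H p` if `c_p` is
different from all other coefficients. -/
lemma map_mem_of_commute {c : Fin 4 → ℂ} {p : Fin 4} (hc : ∀ q, q ≠ p → c q ≠ c p)
    {N : (Fin 4 → ℂ) →ₗ[ℂ] (Fin 4 → ℂ)}
    (hN : ∀ v, N ((∑ q, c q • h.proj q) v) = (∑ q, c q • h.proj q) (N v))
    {v : Fin 4 → ℂ} (hv : v ∈ h.H p) : N v ∈ h.H p := by
  have h0 : ∀ q, q ≠ p → h.proj q (N v) = 0 := by
    intro q hq
    have h1 : (∑ q, c q • h.proj q) v = c p • v := by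
      simp [LinearMap.sum_apply, h.proj_of_mem hv]
    -- The `q`-component of the commutation relation reads `c p • proj q (N v) = c q • proj q (N
    -- v)`.
    have h2 := congrArg (h.proj q) (hN v)
    rw [h1] at h2
    simp only [map_smul, LinearMap.sum_apply, LinearMap.smul_apply, map_sum, h.proj_proj, smul_ite,
      smul_zero, Finset.sum_ite_eq, Finset.mem_univ, if_true] at h2
    rw [← sub_eq_zero, ← sub_smul, smul_eq_zero] at h2
    exact h2.resolve_left (sub_ne_zero.2 (hc q hq).symm)
  have h3 := h.sum_proj (N v)
  rw [Finset.sum_eq_single p (fun q _ hq => h0 q hq) (by simp)] at h3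
  rw [← h3]
  exact h.proj_mem p _

lemma mem_F_three {v : Fin 4 → ℂ} : v ∈ h.F 3 ↔ v ∈ h.H 3 := by
  have : h.F 3 = h.H 3 := by
    refine le_antisymm (iSup₂_le fun r hr => ?_) (le_iSup₂_of_le (3 : Fin 4) (by simp) le_rfl)
    have : r = 3 := by ext; simp; omega
    rw [this]
  rw [this]

lemma H_le_F {p : ℕ} {r : Fin 4} (hr : p ≤ (r : ℕ)) : h.H r ≤ h.F p :=
  le_iSup₂_of_le r hr le_rfl

/-- This makes `h(z)` an isometry of `Q`, which pairs `H p` only with `H p.rev`. -/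
lemma character_mul_character_rev (p : Fin 4) (z : Circle) :
    character p z * character p.rev z = 1 := by
  have hz : (z : ℂ) * starRingEnd ℂ (z : ℂ) = 1 := by
    rw [Complex.mul_conj, Circle.normSq_coe, Complex.ofReal_one]
  have : character p z * character p.rev z = ((z : ℂ) * starRingEnd ℂ (z : ℂ)) ^ 3 := by
    fin_cases p <;> simp [character, Fin.rev] <;> ring
  rw [this, hz, one_pow]

lemma character_exp (p : Fin 4) (t : ℝ) :
    character p (Circle.exp t) = Complex.exp (t * (Complex.I * (2 * (p : ℕ) - 3))) := by
  rw [character, Circle.coe_exp, ← Complex.exp_conj, ← Complex.exp_nat_mul, ← Complex.exp_nat_mul,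
    ← Complex.exp_add]
  congr 1
  rw [Nat.cast_sub (by omega)]
  simp only [map_mul, Complex.conj_ofReal, Complex.conj_I]
  push_cast
  ring

lemma complexRep_neg_one : h.complexRep (-1) = -1 := by
  have : ∀ p, character p (-1) = -1 := by
    intro p; fin_cases p <;> simp [character] <;> norm_num
  ext1 v
  refine LinearMap.ext fun w => ?_
  simp [complexRep, this, h.sum_proj]

lemma map_rep (z : Circle) : (h.rep z).val.map Complex.ofRealHom =
    LinearMap.toMatrix' (h.complexRep z) :=
  h.realMatrix_map z

/-- The complexification of the derivative of `h.rep` at `1`. -/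
noncomputable def complexDeriv : (Fin 4 → ℂ) →ₗ[ℂ] (Fin 4 → ℂ) :=
  ∑ p : Fin 4, (Complex.I * (2 * ((p : ℕ) : ℂ) - 3)) • h.proj p

/-- The derivative of `h.rep` at `1`. -/
noncomputable def realDeriv : Matrix (Fin 4) (Fin 4) ℝ :=
  (LinearMap.toMatrix' h.complexDeriv).map Complex.re

lemma hasDerivAt_toMatrix'_complexRep (i j : Fin 4) :
    HasDerivAt (fun t : ℝ => LinearMap.toMatrix' (h.complexRep (Circle.exp t)) i j)
      (LinearMap.toMatrix' h.complexDeriv i j) 0 := by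
  simp only [complexRep, complexDeriv, map_sum, Matrix.sum_apply, map_smul, Matrix.smul_apply,
    character_exp, smul_eq_mul]
  refine HasDerivAt.fun_sum fun p _ => HasDerivAt.mul_const ?_ _
  have := ((Complex.ofRealCLM.hasDerivAt (x := (0 : ℝ))).mul_const
    (Complex.I * (2 * ((p : ℕ) : ℂ) - 3))).cexp
  simpa using this

lemma hasDerivAt_realMatrix (i j : Fin 4) :
    HasDerivAt (fun t : ℝ => h.realMatrix (Circle.exp t) i j) (h.realDeriv i j) 0 :=
  Complex.reCLM.hasFDerivAt.comp_hasDerivAt (0 : ℝ) (h.hasDerivAt_toMatrix'_complexRep i j)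

/-- The entries of `complexRep` along the circle are real, so their derivatives lose nothing when
real parts are taken. -/
lemma realDeriv_map :
    h.realDeriv.map Complex.ofRealHom = LinearMap.toMatrix' h.complexDeriv := by
  ext i j
  refine HasDerivAt.unique ?_ (h.hasDerivAt_toMatrix'_complexRep i j)
  simp only [← realMatrix_map]
  exact (h.hasDerivAt_realMatrix i j).ofReal_comp

end HodgeStructure

/-! ### Infinitesimal generators in the Lie algebra -/

/-- The chain rule for a polynomial function along a curve. -/
lemma hasDerivAt_eval {σ : Type*} [Fintype σ] [DecidableEq σ] (P : MvPolynomial σ ℝ)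
    {x : ℝ → σ → ℝ} {x' : σ → ℝ} {t : ℝ} (hx : ∀ i, HasDerivAt (fun s => x s i) (x' i) t) :
    HasDerivAt (fun s => MvPolynomial.eval (x s) P)
      (∑ i, x' i * MvPolynomial.eval (x t) (MvPolynomial.pderiv i P)) t := by
  induction P using MvPolynomial.induction_on with
  | C a => simpa using hasDerivAt_const t a
  | add p q hp hq =>
    simp only [map_add, mul_add, Finset.sum_add_distrib]
    exact hp.add hq
  | mul_X p i hp =>
    simp only [map_mul, MvPolynomial.eval_X]
    refine (hp.mul (hx i)).congr_deriv ?_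
    simp only [MvPolynomial.pderiv_X, Derivation.leibniz, Pi.single_apply, smul_eq_mul, map_add,
      map_mul, MvPolynomial.eval_X, mul_add, Finset.sum_add_distrib, Finset.sum_mul, apply_ite,
      map_zero, mul_one, mul_zero, Finset.sum_ite_eq, Finset.mem_univ, if_true]
    rw [add_comm]
    exact congrArg₂ (· + ·) (mul_comm _ _) (Finset.sum_congr rfl fun _ _ => by ring)

/-- A polynomial vanishing on `G` vanishes along the curve `t ↦ h(exp(it))`; by the chain rule its
derivative at `t = 0` is `derivAtOne`. -/
lemma realDeriv_mem_lieAlgebra {G : Subgroup (GL (Fin 4) ℂ)} {h : HodgeStructure}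
    (hG : ∀ z, h.rep z ∈ realPoints G) : h.realDeriv ∈ lieAlgebra G := by
  intro P hP
  have h1 := hasDerivAt_eval P (x := fun t ij => h.realMatrix (Circle.exp t) ij.1 ij.2)
    (fun ij => h.hasDerivAt_realMatrix ij.1 ij.2)
  have h2 : ∀ t : ℝ,
      MvPolynomial.eval (fun ij => h.realMatrix (Circle.exp t) ij.1 ij.2) P = 0 := by
    intro t
    have h3 := hP _ (hG (Circle.exp t))
    have h4 : MvPolynomial.aeval (algebraMap ℝ ℂ ∘ fun ij : Fin 4 × Fin 4 =>
        h.realMatrix (Circle.exp t) ij.1 ij.2) P = 0 := h3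
    rw [MvPolynomial.aeval_algebraMap_apply] at h4
    simpa [MvPolynomial.aeval_eq_eval] using h4
  simp only [h2] at h1
  have h5 : h.realMatrix (Circle.exp 0) = 1 := by
    rw [Circle.exp_zero]; exact congrArg Units.val (map_one h.rep)
  rw [h5] at h1
  exact h1.unique (hasDerivAt_const _ _)

/-! ### The isometry group of the polarization -/

lemma bilin_mulVec (A : Matrix (Fin 4) (Fin 4) ℚ) (M : Matrix (Fin 4) (Fin 4) ℂ)
    (v w : Fin 4 → ℂ) : bilin A (M.mulVec v) (M.mulVec w) =
      v ⬝ᵥ (M.transpose * A.map (algebraMap ℚ ℂ) * M).mulVec w := by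
  simp only [bilin, ← Matrix.mulVec_mulVec]
  rw [Matrix.dotProduct_mulVec v, Matrix.vecMul_transpose]

/-- The group of complex matrices that preserve the bilinear form with matrix `A`. -/
def isometryGroup (A : Matrix (Fin 4) (Fin 4) ℚ) : Subgroup (GL (Fin 4) ℂ) where
  carrier := {g | ∀ v w, bilin A (g.val.mulVec v) (g.val.mulVec w) = bilin A v w}
  one_mem' := by simp
  mul_mem' := fun {g g'} hg hg' v w => by
    rw [Units.val_mul, ← Matrix.mulVec_mulVec, ← Matrix.mulVec_mulVec, hg, hg']
  inv_mem' := fun {g} hg v w => by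
    rw [← hg, Matrix.mulVec_mulVec, Matrix.mulVec_mulVec, ← Units.val_mul, mul_inv_cancel]
    simp

lemma mem_isometryGroup_iff {A : Matrix (Fin 4) (Fin 4) ℚ} {g : GL (Fin 4) ℂ} :
    g ∈ isometryGroup A ↔
      g.val.transpose * A.map (algebraMap ℚ ℂ) * g.val = A.map (algebraMap ℚ ℂ) := by
  change (∀ v w, bilin A (g.val.mulVec v) (g.val.mulVec w) = bilin A v w) ↔ _
  simp only [bilin_mulVec]
  constructor
  · intro H
    ext i j
    simpa [bilin] using H (Pi.single i 1) (Pi.single j 1)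
  · intro H v w
    rw [H, bilin]

/-- The equations are the entries of `gᵀ A g - A`, rational because `A` is. -/
lemma isRatAlgebraic_isometryGroup (A : Matrix (Fin 4) (Fin 4) ℚ) :
    IsRatAlgebraic (isometryGroup A) := by
  refine ⟨Set.range fun ij : Fin 4 × Fin 4 =>
    (∑ l, (∑ k, MvPolynomial.X (k, ij.1) * MvPolynomial.C (A k l)) * MvPolynomial.X (l, ij.2)) -
      MvPolynomial.C (A ij.1 ij.2), fun g => ?_⟩
  rw [mem_isometryGroup_iff, ← Matrix.ext_iff]
  simp only [Set.forall_mem_range, Prod.forall]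
  simp [Matrix.mul_apply, sub_eq_zero]

lemma complexify_rep_mulVec (h : HodgeStructure) (z : Circle) (v : Fin 4 → ℂ) :
    (complexify (h.rep z)).val.mulVec v = h.complexRep z v := by
  have : (complexify (h.rep z)).val = LinearMap.toMatrix' (h.complexRep z) := h.map_rep z
  rw [this, LinearMap.toMatrix'_mulVec]

namespace PolarizedVHS

variable {B : Set ℂ} (𝒱 : PolarizedVHS B)

lemma bilin_complexRep (b : B) (z : Circle) (v w : Fin 4 → ℂ) :
    bilin 𝒱.Q ((𝒱.fiber b).complexRep z v) ((𝒱.fiber b).complexRep z w) = bilin 𝒱.Q v w := by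
  have htop : ∀ v, v ∈ ⨆ p, (𝒱.fiber b).H p := fun v => by
    rw [(𝒱.fiber b).isInternal.submodule_iSup_eq_top]; trivial
  induction htop v using Submodule.iSup_induction' with
  | zero => simp [bilin]
  | add x y _ _ hx hy =>
    simp only [bilin, map_add, add_dotProduct] at hx hy ⊢
    rw [hx, hy]
  | mem p x hx =>
    induction htop w using Submodule.iSup_induction' with
    | zero => simp [bilin]
    | add x y _ _ hx hy =>
      simp only [bilin, map_add, Matrix.mulVec_add, dotProduct_add] at hx hy ⊢
      rw [hx, hy]
    | mem q y hy =>
      rw [(𝒱.fiber b).complexRep_of_mem hx, (𝒱.fiber b).complexRep_of_mem hy]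
      have h1 : bilin 𝒱.Q (HodgeStructure.character p z • x) (HodgeStructure.character q z • y) =
          HodgeStructure.character p z * HodgeStructure.character q z * bilin 𝒱.Q x y := by
        simp only [bilin, Matrix.mulVec_smul, smul_dotProduct, dotProduct_smul, smul_eq_mul]
        ring
      rw [h1]
      by_cases hq : q = p.rev
      · rw [hq, HodgeStructure.character_mul_character_rev, one_mul]
      · rw [𝒱.orthogonal b p q hq x hx y hy, mul_zero]

/-- Minimality is used twice: for each Hodge group, then for the generic one. -/
lemma genericHodgeGroup_le_isometryGroup : 𝒱.genericHodgeGroup ≤ isometryGroup 𝒱.Q := by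
  refine sInf_le ⟨isRatAlgebraic_isometryGroup _, fun b =>
    sInf_le ⟨isRatAlgebraic_isometryGroup _, fun z v w => ?_⟩⟩
  rw [complexify_rep_mulVec, complexify_rep_mulVec, 𝒱.bilin_complexRep]

/-! ### Rigidity of endomorphisms preserving `F³` -/

variable {𝒱}

/-- Every fibre `F³` is spanned by the value of a local holomorphic section without zeros. -/
lemma IsCalabiYauLike.exists_frame (h𝒱 : 𝒱.IsCalabiYauLike) (b : B) :
    ∃ (U : Set ℂ) (e : ℂ → Fin 4 → ℂ), IsOpen U ∧ b.1 ∈ U ∧ U ⊆ B ∧ DifferentiableOn ℂ e U ∧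
      ∀ b' : B, b'.1 ∈ U → e b' ≠ 0 ∧ (𝒱.fiber b').F 3 = Submodule.span ℂ {e b'} := by
  obtain ⟨U, hU, hbU, hUB, k, s, hs, hsp⟩ := 𝒱.holomorphic 3 b
  beta_reduce at hsp
  have hF : ∀ b' : B, (𝒱.fiber b').F 3 = (𝒱.fiber b').H 3 := fun b' => by
    ext v; exact (𝒱.fiber b').mem_F_three
  -- The length of a frame is the rank `h^{3,0} = 1` of `F³`.
  have hk : k = 1 := by
    have h1 := finrank_span_eq_card (hsp b hbU).1
    rw [(hsp b hbU).2, hF, h𝒱.hodgeNumber b 3, Fintype.card_fin] at h1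
    exact h1.symm
  subst hk
  refine ⟨U, s 0, hU, hbU, hUB, hs 0, fun b' hb' => ⟨(hsp b' hb').1.ne_zero 0, ?_⟩⟩
  rw [← (hsp b' hb').2]
  congr 1
  ext x
  simp [Fin.exists_fin_one, eq_comm]

/-- An endomorphism that preserves all fibres `F³` acts on each fibre `F²` as a scalar. -/
lemma IsCalabiYauLike.exists_eigenvalue (h𝒱 : 𝒱.IsCalabiYauLike)
    {N : (Fin 4 → ℂ) →ₗ[ℂ] (Fin 4 → ℂ)}
    (hN : ∀ b, ∀ v ∈ (𝒱.fiber b).H 3, N v ∈ (𝒱.fiber b).H 3) (b : B) :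
    ∃ ξ : ℂ, ∀ v ∈ (𝒱.fiber b).F 2, N v = ξ • v := by
  obtain ⟨U, e, hU, hbU, hUB, he, hspan⟩ := h𝒱.exists_frame b
  -- The eigenvalue is made a function on all of `ℂ`, with irrelevant value off `U`.
  have hex : ∀ x : ℂ, ∃ c : ℂ, x ∈ U → N (e x) = c • e x := by
    intro x
    by_cases hx : x ∈ U
    · have hx' := hspan ⟨x, hUB hx⟩ hx
      have h1 : e x ∈ (𝒱.fiber ⟨x, hUB hx⟩).F 3 := by
        rw [hx'.2]; exact Submodule.mem_span_singleton_self _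
      have h2 := hN _ _ ((𝒱.fiber _).mem_F_three.1 h1)
      rw [← HodgeStructure.mem_F_three, hx'.2, Submodule.mem_span_singleton] at h2
      obtain ⟨c, hc⟩ := h2
      exact ⟨c, fun _ => hc.symm⟩
    · exact ⟨0, fun h => absurd h hx⟩
  choose c hc using hex
  have heig : ∀ x ∈ U, c x ∈ {μ | Module.End.HasEigenvalue N μ} := fun x hx =>
    Module.End.hasEigenvalue_of_hasEigenvector
      ⟨Module.End.mem_eigenspace_iff.2 (hc x hx), (hspan ⟨x, hUB hx⟩ hx).1⟩
  have hfin : {μ | Module.End.HasEigenvalue N μ}.Finite := Module.End.finite_hasEigenvalue N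
  -- Near `b`, `c` is the quotient of the `i`-th coordinates of `N e` and `e`, where `e b i ≠ 0`.
  have hcont : ContinuousAt c b := by
    obtain ⟨i, hi⟩ := Function.ne_iff.1 (hspan b hbU).1
    have hec : ContinuousAt e b := (he.continuousOn).continuousAt (hU.mem_nhds hbU)
    have hei : ContinuousAt (fun x => e x i) b := continuousAt_pi.1 hec i
    have hNe : ContinuousAt (fun x => N (e x) i) b :=
      continuousAt_pi.1 ((LinearMap.continuous_of_finiteDimensional N).continuousAt.comp hec) i
    refine (hNe.div hei hi).congr ?_
    filter_upwards [hU.mem_nhds hbU, hei.eventually_ne hi] with x hx hxi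
    change N (e x) i / e x i = c x
    rw [hc x hx]
    exact mul_div_cancel_right₀ _ hxi
  have hconst : ∀ᶠ x in nhds b.1, c x = c b := by
    -- Finiteness of the spectrum separates `c b` from the other eigenvalues.
    have hcl : IsClosed ({μ | Module.End.HasEigenvalue N μ} \ {c b}) := hfin.sdiff.isClosed
    filter_upwards [hU.mem_nhds hbU, hcont.eventually (hcl.isOpen_compl.mem_nhds (by simp))]
      with x hx hx'
    by_contra hne
    exact hx' ⟨heig x hx, hne⟩
  refine ⟨c b, fun v hv => ?_⟩
  rw [h𝒱.generated b] at hv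
  have hle : Submodule.span ℂ {w | ∃ s, IsLocalSection (fun b => (𝒱.fiber b).F 3) b s ∧
      (w = s b ∨ w = deriv s b)} ≤ Module.End.eigenspace N (c b) := by
    rw [Submodule.span_le]
    rintro w ⟨s, ⟨U', hU', hbU', hU'B, hs, hsF⟩, hw⟩
    have hev : ∀ᶠ x in nhds b.1, N (s x) = c b • s x := by
      filter_upwards [hconst, hU.mem_nhds hbU, hU'.mem_nhds hbU'] with x hx hxU hxU'
      have h1 : s x ∈ (𝒱.fiber ⟨x, hUB hxU⟩).F 3 := hsF ⟨x, hUB hxU⟩ hxU'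
      rw [(hspan ⟨x, hUB hxU⟩ hxU).2, Submodule.mem_span_singleton] at h1
      obtain ⟨a, ha⟩ := h1
      rw [← ha, map_smul, hc x hxU, hx, smul_comm]
    rw [SetLike.mem_coe, Module.End.mem_eigenspace_iff]
    rcases hw with rfl | rfl
    · exact hev.self_of_nhds
    -- As `c` is constant near `b`, differentiating `N s = c b • s` gives no extra term.
    · have hd : HasDerivAt s (deriv s b) b :=
        ((hs b hbU').differentiableAt (hU'.mem_nhds hbU')).hasDerivAt
      have h1 : HasDerivAt (fun x => N (s x)) (N (deriv s b)) b :=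
        (LinearMap.toContinuousLinearMap N).hasFDerivAt.comp_hasDerivAt b.1 hd
      exact h1.unique ((hd.const_smul (c b)).congr_of_eventuallyEq hev)
  exact Module.End.mem_eigenspace_iff.1 (hle hv)

end PolarizedVHS

/-! ### Complexified real matrices and a separating point of the circle -/

lemma toLin'_map_ofReal_star (M : Matrix (Fin 4) (Fin 4) ℝ) (v : Fin 4 → ℂ) :
    Matrix.toLin' (M.map Complex.ofRealHom) (star v) =
      star (Matrix.toLin' (M.map Complex.ofRealHom) v) := by
  ext i
  simp [Matrix.mulVec, dotProduct]

/-- Real matrices that commute have commuting complexifications. -/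
lemma toLin'_map_comm {M M' : Matrix (Fin 4) (Fin 4) ℝ} (hM : M * M' = M' * M)
    {N N' : (Fin 4 → ℂ) →ₗ[ℂ] (Fin 4 → ℂ)}
    (hN : M.map Complex.ofRealHom = LinearMap.toMatrix' N)
    (hN' : M'.map Complex.ofRealHom = LinearMap.toMatrix' N') (v : Fin 4 → ℂ) :
    N (N' v) = N' (N v) := by
  have h1 := congrArg (fun M => M.map Complex.ofRealHom) hM
  simp only [Matrix.map_mul, hN, hN', ← LinearMap.toMatrix'_mul] at h1
  exact LinearMap.congr_fun (LinearMap.toMatrix'.injective h1) v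

/-- The point `(3 + 4i) / 5` of the circle. -/
noncomputable def pythagoreanPoint : Circle :=
  ⟨⟨3 / 5, 4 / 5⟩, by
    rw [← SetLike.mem_coe, Submonoid.coe_unitSphere, mem_sphere_zero_iff_norm, ← sq_eq_sq₀ (norm_nonneg _) zero_le_one, Complex.sq_norm,
      Complex.normSq_mk]
    norm_num⟩

/-- The imaginary parts of the four characters here are explicit distinct rationals, so `h_b` at
this single point detects `H^{3,0}`. -/
lemma character_pythagoreanPoint (q : Fin 4) (hq : q ≠ 3) :
    HodgeStructure.character q pythagoreanPoint ≠ HodgeStructure.character 3 pythagoreanPoint := by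
  intro H
  have h2 := congrArg Complex.im H
  fin_cases q <;> first | exact hq rfl | skip
  all_goals
    simp [HodgeStructure.character, pythagoreanPoint, pow_succ, Complex.mul_re, Complex.mul_im]
      at h2
  all_goals norm_num at h2

end CYHodge
-- The center and the kernel of the adjoint action
open CYHodge in
theorem mainTheorem6 (B : Set ℂ) (hB : IsOpen B) (hB' : IsConnected B)
    (𝒱 : CYHodge.PolarizedVHS B) (h𝒱 : 𝒱.IsCalabiYauLike) (o : B)
    (v : Module.Basis (Fin 4) ℂ (Fin 4 → ℂ)) (hv : 𝒱.IsHodgeBasis o v) :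
    (∀ Z ∈ Subgroup.center (CYHodge.realPoints 𝒱.genericHodgeGroup), ∃ ξ : ℂ, ‖ξ‖ = 1 ∧
      LinearMap.toMatrix v v (Matrix.toLin'
        ((Z : GL (Fin 4) ℝ).val.map Complex.ofRealHom)) =
        Matrix.diagonal ![ξ, ξ, starRingEnd ℂ ξ, starRingEnd ℂ ξ]) ∧
    (((CYHodge.ad 𝒱.genericHodgeGroup).comp (𝒱.rep o)).ker : Set Circle) = {1, -1} := by
  have hv0 : v 0 ∈ (𝒱.fiber o).F 2 := (𝒱.fiber o).H_le_F (by decide) (hv.mem 0)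
  have hv1 : v 1 ∈ (𝒱.fiber o).F 2 := (𝒱.fiber o).H_le_F (by decide) (hv.mem 1)
  constructor
  · intro Z hZ
    set N := Matrix.toLin' ((Z : GL (Fin 4) ℝ).val.map Complex.ofRealHom) with hNdef
    have hNM : (Z : GL (Fin 4) ℝ).val.map Complex.ofRealHom = LinearMap.toMatrix' N := by
      rw [hNdef, LinearMap.toMatrix'_toLin']
    obtain ⟨ξ, hξ⟩ := h𝒱.exists_eigenvalue (N := N) (fun b w hw =>
      (𝒱.fiber b).map_mem_of_commute character_pythagoreanPoint (fun u =>
        toLin'_map_comm (N' := (𝒱.fiber b).complexRep pythagoreanPoint)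
          (congrArg (fun g : realPoints 𝒱.genericHodgeGroup => (g : GL (Fin 4) ℝ).val)
            (Subgroup.mem_center_iff.1 hZ (𝒱.rep b pythagoreanPoint))).symm hNM
          ((𝒱.fiber b).map_rep pythagoreanPoint) u) hw) o
    -- `Z` is real, so conjugation turns `ξ`-eigenvectors into `conj ξ`-eigenvectors.
    have hstar : ∀ j, N (v j) = ξ • v j → N (v j.rev) = starRingEnd ℂ ξ • v j.rev := by
      intro j hj
      rw [← hv.conj, hNdef, toLin'_map_ofReal_star, ← hNdef, hj, star_smul]
      rfl
    have e0 := hξ _ hv0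
    have e1 := hξ _ hv1
    have e2 : N (v 2) = starRingEnd ℂ ξ • v 2 := hstar 1 e1
    have e3 : N (v 3) = starRingEnd ℂ ξ • v 3 := hstar 0 e0
    refine ⟨ξ, ?_, ?_⟩
    -- Invariance of the nonzero number `Q(v 0, v 3)` yields `ξ * conj ξ = 1`.
    · have h1 : bilin 𝒱.Q (N (v 0)) (N (v 3)) = bilin 𝒱.Q (v 0) (v 3) :=
        𝒱.genericHodgeGroup_le_isometryGroup Z.2 (v 0) (v 3)
      have h2 : bilin 𝒱.Q (v 0) (v 3) ≠ 0 := by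
        intro h0
        have := hv.norm_zero
        simp only [bilin, smul_dotProduct] at this h0
        simp [h0] at this
      rw [e0, e3] at h1
      simp only [bilin, Matrix.mulVec_smul, smul_dotProduct, dotProduct_smul, smul_eq_mul]
        at h1 h2
      rw [← mul_assoc, mul_comm _ ξ, Complex.mul_conj, mul_eq_right₀ h2] at h1
      rw [← sq_eq_sq₀ (norm_nonneg _) zero_le_one, Complex.sq_norm, one_pow]
      exact_mod_cast h1
    · ext i j
      rw [LinearMap.toMatrix_apply]
      fin_cases j <;> fin_cases i <;> simp [e0, e1, e2, e3, Matrix.diagonal]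
  · ext z
    simp only [SetLike.mem_coe, MonoidHom.mem_ker, Set.mem_insert_iff, Set.mem_singleton_iff]
    constructor
    · intro hz
      have hcomm : ∀ X ∈ lieAlgebra 𝒱.genericHodgeGroup,
          ((𝒱.fiber o).rep z).val * X = X * ((𝒱.fiber o).rep z).val := by
        intro X hX
        have h1 : ((𝒱.fiber o).rep z).val * X * ((𝒱.fiber o).rep z)⁻¹.val = X :=
          congrArg Subtype.val (LinearMap.congr_fun hz ⟨X, hX⟩)
        conv_rhs => rw [← h1]
        rw [mul_assoc, ← Units.val_mul, inv_mul_cancel, Units.val_one, mul_one]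
      -- For every `b`, `h_o(z)` commutes with `realDeriv` of the fibre over `b`, whose eigenvalues
      -- `i(2p - 3)` are distinct.
      obtain ⟨ξ, hξ⟩ := h𝒱.exists_eigenvalue (N := (𝒱.fiber o).complexRep z) (fun b w hw =>
        (𝒱.fiber b).map_mem_of_commute (c := fun p => Complex.I * (2 * ((p : ℕ) : ℂ) - 3))
          (fun q hq h => hq (by
            ext
            exact_mod_cast (by simpa using h : ((q : ℕ) : ℂ) = 3)))
          (fun u => toLin'_map_comm (hcomm _ (realDeriv_mem_lieAlgebra
            fun z => (𝒱.rep b z).2)) ((𝒱.fiber o).map_rep z) (𝒱.fiber b).realDeriv_map u) hw) o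
      have c0 := hξ _ hv0
      have c1 := hξ _ hv1
      rw [(𝒱.fiber o).complexRep_of_mem (hv.mem 0)] at c0
      rw [(𝒱.fiber o).complexRep_of_mem (hv.mem 1)] at c1
      -- `v 0` and `v 1` lie in `H^{3,0}` and `H^{2,1}`, so both characters equal the scalar `ξ`.
      have h3 := (smul_left_injective ℂ (v.ne_zero 0) c0).trans
        (smul_left_injective ℂ (v.ne_zero 1) c1).symm
      have h4 : (z : ℂ) ^ 3 = (z : ℂ) ^ 2 * starRingEnd ℂ (z : ℂ) := by
        simpa [HodgeStructure.character, Fin.rev] using h3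
      have h5 : (z : ℂ) * starRingEnd ℂ (z : ℂ) = 1 := by
        rw [Complex.mul_conj, Circle.normSq_coe, Complex.ofReal_one]
      have h6 : (z : ℂ) ^ 2 * ((z : ℂ) ^ 2 - 1) = 0 := by
        linear_combination (z : ℂ) * h4 + (z : ℂ) ^ 2 * h5
      have h7 : (z : ℂ) ^ 2 = 1 := by
        simpa [sub_eq_zero] using h6
      rcases mul_self_eq_one_iff.1 ((sq _).symm.trans h7) with h | h
      · exact Or.inl (Circle.ext h)
      · exact Or.inr (Circle.ext (by simpa using h))
    · rintro (rfl | rfl)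
      · exact map_one _
      · have h1 : ((𝒱.fiber o).rep (-1)).val = -1 := by
          apply HodgeStructure.map_ofReal_injective
          simp only [HodgeStructure.map_rep, HodgeStructure.complexRep_neg_one]
          ext i j
          by_cases hij : i = j <;> simp [hij]
        have h2 : (𝒱.fiber o).rep (-1) = -1 := Units.ext h1
        ext1 X
        apply Subtype.ext
        change ((𝒱.fiber o).rep (-1)).val * X.1 * ((𝒱.fiber o).rep (-1))⁻¹.val = X.1
        rw [h2]
        simp
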